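/- Let $p$ be a prime number and let $F$ be a free pro-$p$ group of rank $2$ on generators $x, y$. Let $F_2 = F^p[F,F]$ be the closed subgroup of $F$ topologically generated by all $p$-th powers and all commutators, and let $F_3$ be the third term of the Zassenhaus filtration of $F$, i.e. the subgroup of all $g \in F$ such that $g-1$ lies in the third power of the augmentation ideal of the completed group algebra $\mathbb{F}_p[[F]]$. Let $r \in F_2$ and let $R$ be the smallest closed normal subgroup of $F$ containing $r$. Recall that a pro-$p$ group $G$ is called a Demushkin group if $H^1(G,\mathbb{F}_p)$ is finite-dimensional, $\dim_{\mathbb{F}_p} H^2(G,\mathbb{F}_p) = 1$, and the cup product $H^1(G,\mathbb{F}_p)\times H^1(G,\mathbb{F}_p)\to H^2(G,\mathbb{F}_p)$ is non-degenerate. If $r \equiv [x,y]^i \pmod{F_3}$ for some integer $i$ prime to $p$, then $F/R$ is a Demushkin group. Conversely, if $p$ is odd and $F/R$ is a Demushkin group, then $r \equiv [x,y]^i \pmod{F_3}$ for some integer $i$ prime to $p$. In particular, for odd $p$, $F/R$ is a Demushkin group if and only if $r \equiv [x,y]^i \pmod{F_3}$ for some integer $i$ prime to $p$. -/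

import Mathlib

universe u

open scoped commutatorElement

noncomputable section

/-- A topological group `G` is a pro-`p` group: it is profinite and every open normal subgroup has
index a power of `p`. -/
structure IsProP (p : ℕ) (G : Type u) [Group G] [TopologicalSpace G] : Prop where
  isTopologicalGroup : IsTopologicalGroup G
  compact : CompactSpace G
  t2 : T2Space G
  totallyDisconnected : TotallyDisconnectedSpace G
  index_eq : ∀ U : OpenNormalSubgroup G, ∃ n : ℕ, U.toSubgroup.index = p ^ n

/-- `F` is a free pro-`p` group of rank two on the generators `x, y`: it is a pro-`p` group, and
every pair of elements `a, b` of a pro-`p` group `G` is the image of `x, y` under exactly one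
continuous homomorphism `F → G`. -/
structure IsFreeProPOn (p : ℕ) {F : Type u} [Group F] [TopologicalSpace F] (x y : F) : Prop where
  isProP : IsProP p F
  existsUnique_lift : ∀ (G : Type u) [Group G] [TopologicalSpace G], IsProP p G →
    ∀ a b : G, ∃! f : F →ₜ* G, f x = a ∧ f y = b

section Subgroups

variable (p : ℕ) (G : Type u) [Group G] [TopologicalSpace G]

/-- The closed subgroup `G ^ p [G, G]`, topologically generated by all `p`-th powers and all
commutators. -/
def powCommSubgroup [IsTopologicalGroup G] : Subgroup G :=
  (Subgroup.closure {g : G | ∃ a : G, a ^ p = g} ⊔ commutator G).topologicalClosure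

/-- The augmentation ideal of the group algebra `𝔽_p[Q]`: the kernel of the algebra homomorphism
to `𝔽_p` that sends every element of `Q` to `1`. -/
def augIdeal (Q : Type u) [Group Q] : Ideal (MonoidAlgebra (ZMod p) Q) :=
  RingHom.ker (MonoidAlgebra.lift (ZMod p) (ZMod p) Q 1)

/-- The Zassenhaus filtration: `g ∈ G_n` if and only if `g - 1` lies in the `n`-th power of the
augmentation ideal of the completed group algebra `𝔽_p⟦G⟧ = lim 𝔽_p[G/U]`, that is, if and only if
for every open normal subgroup `U`, the image of `g - 1` in `𝔽_p[G/U]` lies in the `n`-th power of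
the augmentation ideal of `𝔽_p[G/U]`. -/
def zassenhaus (n : ℕ) : Subgroup G where
  carrier := {g : G | ∀ U : OpenNormalSubgroup G,
    MonoidAlgebra.of (ZMod p) (G ⧸ U.toSubgroup) (g : G ⧸ U.toSubgroup) - 1
      ∈ augIdeal p (G ⧸ U.toSubgroup) ^ n}
  one_mem' U := by rw [QuotientGroup.mk_one, map_one, sub_self]; exact zero_mem _
  mul_mem' {g h} hg hh U := by
    have key := Ideal.add_mem _ (Ideal.mul_mem_left _
      (MonoidAlgebra.of (ZMod p) (G ⧸ U.toSubgroup) (g : G ⧸ U.toSubgroup)) (hh U)) (hg U)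
    rw [mul_sub, mul_one, ← map_mul, sub_add_sub_cancel] at key
    exact key
  inv_mem' {g} hg U := by
    have key := neg_mem (Ideal.mul_mem_left _
      (MonoidAlgebra.of (ZMod p) (G ⧸ U.toSubgroup) (g : G ⧸ U.toSubgroup)⁻¹) (hg U))
    rw [mul_sub, mul_one, ← map_mul, inv_mul_cancel, map_one, neg_sub] at key
    exact key

end Subgroups

/-! Continuous cohomology of `G` in degrees one and two with coefficients in the trivial discrete
module `𝔽_p`, through inhomogeneous cochains. -/

section Cohomology

variable (p : ℕ) (G : Type u) [Group G] [TopologicalSpace G]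

/-- `H¹(G, 𝔽_p)`: continuous homomorphisms from `G` to the discrete additive group `𝔽_p`
(the one-coboundaries vanish, since the action is trivial). -/
def H1 : Submodule (ZMod p) (G → ZMod p) where
  carrier := {f | Continuous f ∧ ∀ g h, f (g * h) = f g + f h}
  zero_mem' := ⟨continuous_const, fun _ _ => by simp⟩
  add_mem' {a b} ha hb := ⟨ha.1.add hb.1, fun g h => by
    simp only [Pi.add_apply, ha.2, hb.2]; ring⟩
  smul_mem' c a ha := ⟨ha.1.const_smul c, fun g h => by
    simp only [Pi.smul_apply, ha.2, smul_eq_mul]; ring⟩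

/-- Continuous inhomogeneous one-cochains. -/
def C1 : Submodule (ZMod p) (G → ZMod p) where
  carrier := {f | Continuous f}
  zero_mem' := continuous_const
  add_mem' ha hb := ha.add hb
  smul_mem' c _ ha := ha.const_smul c

/-- Continuous inhomogeneous two-cocycles. -/
def Z2 : Submodule (ZMod p) (G × G → ZMod p) where
  carrier := {f | Continuous f ∧
    ∀ g h k, f (h, k) - f (g * h, k) + f (g, h * k) - f (g, h) = 0}
  zero_mem' := ⟨continuous_const, fun _ _ _ => by simp⟩
  add_mem' {a b} ha hb := ⟨ha.1.add hb.1, fun g h k => by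
    simp only [Pi.add_apply]; linear_combination ha.2 g h k + hb.2 g h k⟩
  smul_mem' c a ha := ⟨ha.1.const_smul c, fun g h k => by
    simp only [Pi.smul_apply, smul_eq_mul]; linear_combination c * ha.2 g h k⟩

/-- The coboundary of inhomogeneous one-cochains, `(df)(g, h) = f(h) - f(gh) + f(g)`. -/
def d1 : (G → ZMod p) →ₗ[ZMod p] (G × G → ZMod p) where
  toFun f := fun q => f q.2 - f (q.1 * q.2) + f q.1
  map_add' a b := by ext q; simp only [Pi.add_apply]; ring
  map_smul' c a := by ext q; simp only [Pi.smul_apply, smul_eq_mul, RingHom.id_apply]; ring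

/-- Two-coboundaries of continuous one-cochains, as a submodule of the continuous two-cocycles. -/
def B2 : Submodule (ZMod p) (Z2 p G) :=
  ((C1 p G).map (d1 p G)).comap (Z2 p G).subtype

/-- `H²(G, 𝔽_p)`. -/
abbrev H2 : Type u := Z2 p G ⧸ B2 p G

/-- The cup product on the level of cocycles, `(χ ∪ ψ)(g, h) = χ(g) ψ(h)`. -/
def cupCocycle : H1 p G →ₗ[ZMod p] H1 p G →ₗ[ZMod p] Z2 p G :=
  LinearMap.mk₂ (ZMod p)
    (fun χ ψ => ⟨fun q => χ.1 q.1 * ψ.1 q.2,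
      (χ.2.1.comp continuous_fst).mul (ψ.2.1.comp continuous_snd),
      fun g h k => by simp only [χ.2.2, ψ.2.2]; ring⟩)
    (fun a b c => by ext q; simp [add_mul])
    (fun c a b => by ext q; simp [mul_assoc])
    (fun a b c => by ext q; simp [mul_add])
    (fun c a b => by ext q; simp [mul_left_comm])

/-- The cup product `H¹(G, 𝔽_p) × H¹(G, 𝔽_p) → H²(G, 𝔽_p)`. -/
def cup : H1 p G →ₗ[ZMod p] H1 p G →ₗ[ZMod p] H2 p G :=
  (cupCocycle p G).compr₂ (B2 p G).mkQ

/-- `G` is a Demushkin group (for the prime `p`): a pro-`p` group such that `H¹(G, 𝔽_p)` is finite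
dimensional, `H²(G, 𝔽_p)` is one dimensional, and the cup product
`H¹(G, 𝔽_p) × H¹(G, 𝔽_p) → H²(G, 𝔽_p)` is non-degenerate. -/
structure IsDemushkin : Prop where
  isProP : IsProP p G
  finite_H1 : Module.Finite (ZMod p) (H1 p G)
  finrank_H2 : Module.finrank (ZMod p) (H2 p G) = 1
  nondegenerate : (cup p G).Nondegenerate

end Cohomology

/-- The smallest closed normal subgroup of `G` that contains `r`. -/
def closedNormalClosure {G : Type u} [Group G] [TopologicalSpace G] [IsTopologicalGroup G]
    (r : G) : Subgroup G :=
  (Subgroup.normalClosure {r}).topologicalClosure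

instance closedNormalClosure_normal {G : Type u} [Group G] [TopologicalSpace G]
    [IsTopologicalGroup G] (r : G) : (closedNormalClosure r).Normal :=
  Subgroup.is_normal_topologicalClosure _

end

/-! Write `N` for the closed normal closure of `r`. The central extension of `F` by `𝔽_p` attached
to a two-cocycle is again pro-`p`, so the universal property splits it: every continuous two-cocycle
on `F` is the coboundary of some `u` (`IsFreeProPOn.exists_eq_coboundary`). For a cocycle inflated
from `F ⧸ N`, the number `u r - u 1` is the transgression of its class, and it vanishes exactly when
the cocycle is already a coboundary on `F ⧸ N` (`mem_B2_iff`). Hence `H²` of the quotient is at most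
one-dimensional. Since `r` lies in `F^p[F,F]`, `H¹` of the quotient has the basis dual to `x, y`.

For a cup product `χ ∪ ψ`, the triple `χ, ψ, -u` forms a unitriangular 3×3 representation. Such a
representation kills the third Zassenhaus term, so `u r` depends only on `r` modulo that term; for
`r ≡ [x,y]^i` it is `-i` times the determinant of `χ, ψ` on `x, y`
(`apply_eq_of_mul_mem_zassenhaus`). The cup product is therefore non-degenerate when `p ∤ i` and
zero when `p ∣ i`. For odd `p`, all `p`-th powers lie in the third term, so every `r` in `F^p[F,F]`
is congruent to some `[x,y]^i`, which gives the converse. -/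

/-! ### Pro-`p` groups: closed subgroups, quotients, generation. -/

/-- In a pro-`p` group, every element has a `p`-power in any given open normal subgroup. -/
theorem IsProP.exists_pow_mem {p : ℕ} {G : Type u} [Group G] [TopologicalSpace G]
    (hG : IsProP p G) (U : OpenNormalSubgroup G) (g : G) : ∃ n : ℕ, g ^ p ^ n ∈ U.toSubgroup := by
  obtain ⟨n, hn⟩ := hG.index_eq U
  exact ⟨n, hn ▸ U.toSubgroup.pow_index_mem g⟩

/-- A profinite group in which every element has a `p`-power in each open normal subgroup is
pro-`p`. -/
theorem IsProP.of_exists_pow_mem (p : ℕ) [Fact p.Prime] {G : Type u} [Group G]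
    [TopologicalSpace G] [IsTopologicalGroup G] [CompactSpace G] [T2Space G]
    [TotallyDisconnectedSpace G]
    (h : ∀ (U : OpenNormalSubgroup G) (g : G), ∃ n : ℕ, g ^ p ^ n ∈ U.toSubgroup) :
    IsProP p G where
  isTopologicalGroup := inferInstance
  compact := inferInstance
  t2 := inferInstance
  totallyDisconnected := inferInstance
  index_eq U := by
    have : Finite (G ⧸ U.toSubgroup) := U.toOpenSubgroup.toSubgroup.quotient_finite_of_isOpen U.isOpen'
    refine IsPGroup.iff_card.mp fun q => ?_
    obtain ⟨g, rfl⟩ := QuotientGroup.mk_surjective q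
    obtain ⟨n, hn⟩ := h U g
    exact ⟨n, by rw [← QuotientGroup.mk_pow, QuotientGroup.eq_one_iff]; exact hn⟩

/-- A closed subgroup of a pro-`p` group is pro-`p`. -/
theorem IsProP.of_isClosed {p : ℕ} [Fact p.Prime] {G : Type u} [Group G] [TopologicalSpace G]
    (hG : IsProP p G) (H : Subgroup G) (hH : IsClosed (H : Set G)) : IsProP p H := by
  have := hG.isTopologicalGroup
  have := hG.compact
  have := hG.t2
  have := hG.totallyDisconnected
  have : CompactSpace H := isCompact_iff_compactSpace.mp hH.isCompact
  refine IsProP.of_exists_pow_mem p fun V h => ?_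
  obtain ⟨W, hW, hWV⟩ := isOpen_induced_iff.mp V.isOpen'
  have h1 : (1 : G) ∈ W := by
    have : (1 : H) ∈ Subtype.val ⁻¹' W := hWV ▸ V.toSubgroup.one_mem
    exact this
  obtain ⟨U, hU⟩ := ProfiniteGrp.exist_openNormalSubgroup_sub_open_nhds_of_one hW h1
  obtain ⟨n, hn⟩ := hG.exists_pow_mem U h
  refine ⟨n, ?_⟩
  have : h ^ p ^ n ∈ Subtype.val ⁻¹' W := hU (by rw [Subgroup.coe_pow]; exact hn)
  rw [hWV] at this
  exact this

/-- The quotient of a pro-`p` group by a closed normal subgroup is pro-`p`. -/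
theorem IsProP.quotient {p : ℕ} [Fact p.Prime] {G : Type u} [Group G] [TopologicalSpace G]
    (hG : IsProP p G) (N : Subgroup G) [N.Normal] (hN : IsClosed (N : Set G)) :
    IsProP p (G ⧸ N) := by
  have := hG.isTopologicalGroup
  have := hG.compact
  have := hG.totallyDisconnected
  have : T3Space (G ⧸ N) := QuotientGroup.instT3Space (hN := hN)
  have : TotallySeparatedSpace (G ⧸ N) := by
    refine totallySeparatedSpace_iff_exists_isClopen.mpr fun a b hab => ?_
    obtain ⟨g, rfl⟩ := QuotientGroup.mk_surjective a
    obtain ⟨h, rfl⟩ := QuotientGroup.mk_surjective b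
    have hW : IsOpen {k : G | g⁻¹ * h * k ∉ N} :=
      hN.isOpen_compl.preimage (continuous_const.mul continuous_id)
    have h1 : (1 : G) ∈ {k : G | g⁻¹ * h * k ∉ N} := by
      simpa [← QuotientGroup.eq] using hab
    obtain ⟨U, hU⟩ := ProfiniteGrp.exist_openNormalSubgroup_sub_open_nhds_of_one hW h1
    have hopen : IsOpen ((U.toSubgroup.map (QuotientGroup.mk' N) : Subgroup (G ⧸ N)) :
        Set (G ⧸ N)) := by
      rw [Subgroup.coe_map]
      exact QuotientGroup.isOpenMap_coe _ U.isOpen'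
    have hclopen : IsClopen ((U.toSubgroup.map (QuotientGroup.mk' N) : Subgroup (G ⧸ N)) :
        Set (G ⧸ N)) := ⟨Subgroup.isClosed_of_isOpen _ hopen, hopen⟩
    -- The coset of the image of `U` through `g` separates: if it contained `h`, some `k ∈ U` would
    -- give `g⁻¹ h k⁻¹ ∈ N`, against the choice of `U`.
    refine ⟨{c | (g : G ⧸ N)⁻¹ * c ∈ U.toSubgroup.map (QuotientGroup.mk' N)},
      hclopen.preimage (continuous_const_mul _), ⟨1, one_mem _, by simp⟩, fun hmem => ?_⟩
    obtain ⟨k, hk, hkeq⟩ := hmem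
    refine hU (inv_mem hk : k⁻¹ ∈ U.toSubgroup) ?_
    rw [← QuotientGroup.eq_one_iff]
    simp only [QuotientGroup.mk'_apply] at hkeq
    simp [← hkeq]
  refine IsProP.of_exists_pow_mem p fun V a => ?_
  obtain ⟨g, rfl⟩ := QuotientGroup.mk_surjective a
  let U : OpenNormalSubgroup G :=
    { toSubgroup := V.toSubgroup.comap (QuotientGroup.mk' N)
      isOpen' := V.isOpen'.preimage QuotientGroup.continuous_mk
      isNormal' := inferInstance }
  obtain ⟨n, hn⟩ := hG.exists_pow_mem U g
  exact ⟨n, by simpa [U] using hn⟩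

/-- A closed subgroup of a free pro-`p` group containing the generators is everything. -/
theorem IsFreeProPOn.mem_of_isClosed {p : ℕ} [Fact p.Prime] {F : Type u} [Group F]
    [TopologicalSpace F] {x y : F} (hF : IsFreeProPOn p x y) (H : Subgroup F)
    (hH : IsClosed (H : Set F)) (hx : x ∈ H) (hy : y ∈ H) (g : F) : g ∈ H := by
  obtain ⟨f, ⟨hfx, hfy⟩, -⟩ :=
    hF.existsUnique_lift H (hF.isProP.of_isClosed H hH) ⟨x, hx⟩ ⟨y, hy⟩
  let i : H →ₜ* F := ⟨H.subtype, continuous_subtype_val⟩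
  -- By uniqueness, `F → H → F` is the identity, so every element lies in `H`.
  have := (hF.existsUnique_lift F hF.isProP x y).unique (y₁ := i.comp f)
    (y₂ := ContinuousMonoidHom.id F) ⟨congrArg Subtype.val hfx, congrArg Subtype.val hfy⟩ ⟨rfl, rfl⟩
  have hg : (f g : F) = g := DFunLike.congr_fun this g
  exact hg ▸ (f g).2

/-! ### Two-cocycles and central extensions by `𝔽_p`. -/

theorem Z2.one_left {p : ℕ} {G : Type u} [Group G] [TopologicalSpace G] (f : Z2 p G) (g : G) :
    f.1 (1, g) = f.1 (1, 1) := by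
  have := f.2.2 1 1 g
  simp only [one_mul] at this
  linear_combination this

theorem Z2.one_right {p : ℕ} {G : Type u} [Group G] [TopologicalSpace G] (f : Z2 p G) (g : G) :
    f.1 (g, 1) = f.1 (1, 1) := by
  have := f.2.2 g 1 1
  simp only [mul_one] at this
  linear_combination -this

/-- The central extension of `G` by `𝔽_p` given by a two-cocycle, normalised so that a section
`g ↦ (g, u g)` is a homomorphism if and only if the cocycle is the coboundary of `u`. -/
@[ext]
structure CocycleExt {p : ℕ} {G : Type u} [Group G] [TopologicalSpace G] (f : Z2 p G) :
    Type u where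
  /-- The image in `G`. -/
  base : G
  /-- The component in `𝔽_p`. -/
  coord : ZMod p

namespace CocycleExt

variable {p : ℕ} {G : Type u} [Group G] [TopologicalSpace G] (f : Z2 p G)

instance : Mul (CocycleExt f) :=
  ⟨fun a b => ⟨a.base * b.base, a.coord + b.coord - f.1 (a.base, b.base)⟩⟩

instance : One (CocycleExt f) := ⟨⟨1, f.1 (1, 1)⟩⟩

instance : Inv (CocycleExt f) :=
  ⟨fun a => ⟨a.base⁻¹, -a.coord + f.1 (a.base⁻¹, a.base) + f.1 (1, 1)⟩⟩

variable {f}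

@[simp] theorem mul_base (a b : CocycleExt f) : (a * b).base = a.base * b.base := rfl

@[simp] theorem mul_coord (a b : CocycleExt f) :
    (a * b).coord = a.coord + b.coord - f.1 (a.base, b.base) := rfl

@[simp] theorem one_base : (1 : CocycleExt f).base = 1 := rfl

@[simp] theorem one_coord : (1 : CocycleExt f).coord = f.1 (1, 1) := rfl

@[simp] theorem inv_base (a : CocycleExt f) : a⁻¹.base = a.base⁻¹ := rfl

@[simp] theorem inv_coord (a : CocycleExt f) :
    a⁻¹.coord = -a.coord + f.1 (a.base⁻¹, a.base) + f.1 (1, 1) := rfl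

variable (f)

instance : Group (CocycleExt f) :=
  Group.ofLeftAxioms
    (fun a b c => by
      ext
      · simp [mul_assoc]
      · simp only [mul_coord, mul_base]
        linear_combination f.2.2 a.base b.base c.base)
    (fun a => by
      ext
      · simp
      · simp only [mul_coord, one_base, one_coord]
        linear_combination -Z2.one_left f a.base)
    (fun a => by
      ext
      · simp
      · simp only [mul_coord, one_coord, inv_base, inv_coord]
        ring)

/-- The extension as a set is the product `G × 𝔽_p`. -/
def equivProd : CocycleExt f ≃ G × ZMod p where
  toFun a := (a.base, a.coord)
  invFun q := ⟨q.1, q.2⟩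

instance : TopologicalSpace (CocycleExt f) := .induced (equivProd f) inferInstance

/-- The extension as a space is the product `G × 𝔽_p`. -/
def homeomorphProd : CocycleExt f ≃ₜ G × ZMod p :=
  (equivProd f).toHomeomorphOfIsInducing ⟨rfl⟩

theorem continuous_base : Continuous (base : CocycleExt f → G) :=
  continuous_fst.comp (homeomorphProd f).continuous

theorem continuous_coord : Continuous (coord : CocycleExt f → ZMod p) :=
  continuous_snd.comp (homeomorphProd f).continuous

variable {f} in
theorem continuous_iff {X : Type*} [TopologicalSpace X] {s : X → CocycleExt f} :
    Continuous s ↔ Continuous (fun a => (s a).base) ∧ Continuous (fun a => (s a).coord) :=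
  (homeomorphProd f).comp_continuous_iff.symm.trans continuous_prodMk

instance [IsTopologicalGroup G] : IsTopologicalGroup (CocycleExt f) where
  continuous_mul := by
    have hf := f.2.1
    have hb := continuous_base f
    have hc := continuous_coord f
    refine continuous_iff.mpr ⟨?_, ?_⟩
    · simp only [mul_base]
      fun_prop
    · simp only [mul_coord]
      fun_prop
  continuous_inv := by
    have hf := f.2.1
    have hb := continuous_base f
    have hc := continuous_coord f
    refine continuous_iff.mpr ⟨?_, ?_⟩
    · simp only [inv_base]
      fun_prop
    · simp only [inv_coord]
      fun_prop

/-- The projection of the extension onto `G`. -/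
def proj : CocycleExt f →ₜ* G where
  toFun := base
  map_one' := rfl
  map_mul' _ _ := rfl
  continuous_toFun := continuous_base f

theorem isOpenMap_proj : IsOpenMap (proj f) :=
  isOpenMap_fst.comp (homeomorphProd f).isOpenMap

/-- The inclusion of `𝔽_p` in the extension. -/
def inr : Multiplicative (ZMod p) →* CocycleExt f where
  toFun b := ⟨1, b.toAdd + f.1 (1, 1)⟩
  map_one' := by ext <;> simp
  map_mul' a b := by
    ext
    · simp
    · simp only [toAdd_mul, mul_coord]
      ring

theorem commute_inr (b : Multiplicative (ZMod p)) (a : CocycleExt f) : Commute (inr f b) a := by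
  ext
  · simp [inr]
  · simp only [inr, MonoidHom.coe_mk, OneHom.coe_mk, mul_coord]
    linear_combination Z2.one_right f a.base - Z2.one_left f a.base

theorem exists_eq_inr {a : CocycleExt f} (ha : proj f a = 1) : ∃ b, inr f b = a :=
  ⟨Multiplicative.ofAdd (a.coord - f.1 (1, 1)),
    CocycleExt.ext ha.symm (sub_add_cancel _ _)⟩

/-- An extension of a pro-`p` group by `𝔽_p` is pro-`p`. -/
theorem isProP [Fact p.Prime] (hG : IsProP p G) : IsProP p (CocycleExt f) := by
  have := hG.isTopologicalGroup
  have := hG.compact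
  have := hG.t2
  have := hG.totallyDisconnected
  have : CompactSpace (CocycleExt f) := (homeomorphProd f).symm.compactSpace
  have : T2Space (CocycleExt f) := (homeomorphProd f).symm.t2Space
  have : TotallyDisconnectedSpace (CocycleExt f) :=
    (homeomorphProd f).symm.totallyDisconnectedSpace
  refine IsProP.of_exists_pow_mem p fun V a => ?_
  let U : OpenNormalSubgroup G :=
    { toSubgroup := V.toSubgroup.map (proj f : CocycleExt f →* G)
      isOpen' := isOpenMap_proj f _ V.isOpen'
      isNormal' := Subgroup.Normal.map inferInstance _ fun g => ⟨⟨g, 0⟩, rfl⟩ }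
  obtain ⟨n, v, hv, hva⟩ := hG.exists_pow_mem U (proj f a)
  -- `a ^ p ^ n` differs from an element of `V` by a central factor of exponent `p`; one more `p`-th
  -- power removes it.
  obtain ⟨b, hb⟩ := exists_eq_inr f (a := v⁻¹ * a ^ p ^ n) (by
    rw [map_mul, map_inv, map_pow]
    exact inv_mul_eq_one.mpr hva)
  refine ⟨n + 1, ?_⟩
  have hbp : b ^ p = 1 := by
    rw [← toAdd_eq_zero, toAdd_pow]
    simp
  have : a ^ p ^ n = v * inr f b := by rw [hb]; group
  rw [pow_succ, pow_mul, this, (commute_inr f b v).symm.mul_pow, ← map_pow, hbp, map_one, mul_one]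
  exact pow_mem hv p

end CocycleExt

/-! ### Cochains on a free pro-`p` group. -/

/-- Continuous two-cocycles with values in `𝔽_p` on a free pro-`p` group are coboundaries, of a
cochain with prescribed values on the generators. -/
theorem IsFreeProPOn.exists_eq_coboundary {p : ℕ} [Fact p.Prime] {F : Type u} [Group F]
    [TopologicalSpace F] {x y : F} (hF : IsFreeProPOn p x y) (f : Z2 p F) (a b : ZMod p) :
    ∃ u : F → ZMod p, Continuous u ∧ (∀ g h, f.1 (g, h) = u g + u h - u (g * h)) ∧
      u x = a ∧ u y = b := by
  obtain ⟨s, ⟨hsx, hsy⟩, -⟩ := hF.existsUnique_lift _ (CocycleExt.isProP f hF.isProP)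
    ⟨x, a⟩ ⟨y, b⟩
  -- The lift `s` is a section of the projection, because the composite fixes both generators; its
  -- coordinate is the required cochain.
  have hid := (hF.existsUnique_lift F hF.isProP x y).unique (y₁ := (CocycleExt.proj f).comp s)
    (y₂ := ContinuousMonoidHom.id F)
    ⟨congrArg (CocycleExt.proj f) hsx, congrArg (CocycleExt.proj f) hsy⟩ ⟨rfl, rfl⟩
  have hfst (g : F) : (s g).base = g := DFunLike.congr_fun hid g
  refine ⟨fun g => (s g).coord,
    (CocycleExt.continuous_coord f).comp s.continuous_toFun,
    fun g h => ?_, congrArg CocycleExt.coord hsx, congrArg CocycleExt.coord hsy⟩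
  simp only [map_mul, CocycleExt.mul_coord, hfst]
  ring

/-- Continuous homomorphisms from a free pro-`p` group to `𝔽_p` may be prescribed on the
generators. -/
theorem IsFreeProPOn.exists_H1 {p : ℕ} [Fact p.Prime] {F : Type u} [Group F]
    [TopologicalSpace F] {x y : F} (hF : IsFreeProPOn p x y) (a b : ZMod p) :
    ∃ χ : H1 p F, χ.1 x = a ∧ χ.1 y = b := by
  -- A cochain bounding the zero cocycle is a homomorphism.
  obtain ⟨u, hu, hmul, hx, hy⟩ := hF.exists_eq_coboundary 0 a b
  refine ⟨⟨u, hu, fun g h => ?_⟩, hx, hy⟩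
  have : (0 : ZMod p) = u g + u h - u (g * h) := hmul g h
  linear_combination this

/-! ### Degree one: kernels and inflation. -/

section H1

variable {p : ℕ} {G : Type u} [Group G] [TopologicalSpace G]

/-- An element of `H¹(G, 𝔽_p)` as a homomorphism to the multiplicative version of `𝔽_p`. -/
def H1.toMonoidHom (χ : H1 p G) : G →* Multiplicative (ZMod p) where
  toFun g := Multiplicative.ofAdd (χ.1 g)
  map_one' := by
    have := χ.2.2 1 1
    rw [mul_one, left_eq_add] at this
    rw [this, ofAdd_zero]
  map_mul' g h := by rw [χ.2.2, ofAdd_add]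

theorem H1.mem_ker (χ : H1 p G) (g : G) : g ∈ (H1.toMonoidHom χ).ker ↔ χ.1 g = 0 := Iff.rfl

theorem H1.map_one (χ : H1 p G) : χ.1 1 = 0 := (H1.mem_ker χ 1).mp (one_mem _)

theorem H1.isClosed_ker (χ : H1 p G) : IsClosed ((H1.toMonoidHom χ).ker : Set G) :=
  (isClosed_singleton (x := (0 : ZMod p))).preimage χ.2.1

theorem H1.apply_eq_zero_of_mem_powCommSubgroup [IsTopologicalGroup G] (χ : H1 p G) {r : G}
    (hr : r ∈ powCommSubgroup p G) : χ.1 r = 0 := by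
  rw [← H1.mem_ker]
  refine Subgroup.topologicalClosure_minimal _ (sup_le ?_ ?_) (H1.isClosed_ker χ) hr
  · rw [Subgroup.closure_le]
    rintro _ ⟨a, rfl⟩
    rw [SetLike.mem_coe, MonoidHom.mem_ker, map_pow, ← toAdd_eq_zero, toAdd_pow]
    simp
  · exact Abelianization.commutator_subset_ker _

/-- Inflation in degree one. -/
def H1.inflate (N : Subgroup G) [N.Normal] : H1 p (G ⧸ N) →ₗ[ZMod p] H1 p G where
  toFun χ := ⟨fun g => χ.1 g, χ.2.1.comp QuotientGroup.continuous_mk, fun g h => χ.2.2 g h⟩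
  map_add' _ _ := rfl
  map_smul' _ _ := rfl

theorem H1.exists_inflate_eq [IsTopologicalGroup G] {r : G} (χ : H1 p G) (hr : χ.1 r = 0) :
    ∃ χ' : H1 p (G ⧸ closedNormalClosure r), H1.inflate _ χ' = χ := by
  have hle : closedNormalClosure r ≤ (H1.toMonoidHom χ).ker :=
    Subgroup.topologicalClosure_minimal _
      (Subgroup.normalClosure_le_normal (Set.singleton_subset_iff.mpr hr)) (H1.isClosed_ker χ)
  let φ := QuotientGroup.lift _ (H1.toMonoidHom χ) hle
  refine ⟨⟨fun q => (φ q).toAdd, ?_, fun a b => congrArg Multiplicative.toAdd (map_mul φ a b)⟩, rfl⟩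
  exact isQuotientMap_quotient_mk'.continuous_iff.mpr χ.2.1

theorem IsFreeProPOn.H1_ext [Fact p.Prime] {x y : G} (hG : IsFreeProPOn p x y) {χ : H1 p G}
    (hx : χ.1 x = 0) (hy : χ.1 y = 0) : χ = 0 :=
  Subtype.ext <| funext fun g => hG.mem_of_isClosed _ (H1.isClosed_ker χ) hx hy g

end H1

/-! ### Transgression: which cocycles on the quotient are coboundaries. -/

/-- Let `u` be a continuous cochain on `F` whose coboundary is inflated from a cocycle on the
quotient of `F` by the closed normal subgroup generated by `r`. The cocycle is a coboundary if and
only if `u r = u 1`. -/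
theorem mem_B2_iff {p : ℕ} {F : Type u} [Group F] [TopologicalSpace F] [IsTopologicalGroup F]
    {r : F} (hr : ∀ χ : H1 p F, χ.1 r = 0) (f : Z2 p (F ⧸ closedNormalClosure r))
    {u : F → ZMod p} (hu : Continuous u)
    (hf : ∀ g h : F, f.1 (↑g, ↑h) = u g + u h - u (g * h)) :
    f ∈ B2 p (F ⧸ closedNormalClosure r) ↔ u r = u 1 := by
  have h11 : f.1 (1, 1) = u 1 := by
    have := hf 1 1
    rw [mul_one] at this
    simpa using this
  have hrN : r ∈ closedNormalClosure r :=
    Subgroup.le_topologicalClosure _ (Subgroup.subset_normalClosure rfl)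
  constructor
  · rintro ⟨w, hw, hwf⟩
    have hwf' (g h : F ⧸ closedNormalClosure r) : f.1 (g, h) = w h - w (g * h) + w g :=
      (congrFun hwf (g, h)).symm
    -- Two cochains with the same coboundary differ by a homomorphism, which vanishes at `r` and at
    -- `1`.
    let v : H1 p F := ⟨fun g => u g - w g, hu.sub (hw.comp QuotientGroup.continuous_mk),
      fun g h => by
        have h1 := hf g h
        rw [hwf'] at h1
        simp only [QuotientGroup.mk_mul]
        linear_combination h1⟩
    have h1 : u r - w r = 0 := hr v
    have h2 : u 1 - w (1 : F) = 0 := H1.map_one v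
    rw [(QuotientGroup.eq_one_iff r).mpr hrN] at h1
    rw [QuotientGroup.mk_one] at h2
    linear_combination h1 - h2
  · intro hur
    have hright {s : F} (hs : s ∈ closedNormalClosure r) (g : F) :
        u (g * s) = u g + u s - u 1 := by
      have := hf g s
      rw [(QuotientGroup.eq_one_iff s).mpr hs, Z2.one_right, h11] at this
      linear_combination this
    have hleft {s : F} (hs : s ∈ closedNormalClosure r) (g : F) :
        u (s * g) = u s + u g - u 1 := by
      have := hf s g
      rw [(QuotientGroup.eq_one_iff s).mpr hs, Z2.one_left, h11] at this
      linear_combination this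
    -- On the normal closure, `u - u 1` is additive and conjugation-invariant, so its zeros form a
    -- closed normal subgroup. That subgroup contains `r`, hence is everything, and `u` descends to
    -- the quotient.
    let K : Subgroup F :=
      { carrier := {s | s ∈ closedNormalClosure r ∧ u s = u 1}
        one_mem' := ⟨one_mem _, rfl⟩
        mul_mem' := fun {s t} hs ht => ⟨mul_mem hs.1 ht.1, by
          rw [hright ht.1, hs.2, ht.2]; ring⟩
        inv_mem' := fun {s} hs => ⟨inv_mem hs.1, by
          have := hright hs.1 s⁻¹
          rw [inv_mul_cancel, hs.2] at this
          linear_combination -this⟩ }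
    have hKn : K.Normal := ⟨fun s hs g => by
      have hc := (closedNormalClosure_normal r).conj_mem s hs.1 g
      refine ⟨hc, ?_⟩
      have h1 := hleft hc g
      rw [inv_mul_cancel_right, hright hs.1, hs.2] at h1
      linear_combination -h1⟩
    have hKc : IsClosed (K : Set F) :=
      (Subgroup.isClosed_topologicalClosure _).inter (isClosed_eq hu continuous_const)
    have hle : closedNormalClosure r ≤ K :=
      Subgroup.topologicalClosure_minimal _
        (Subgroup.normalClosure_le_normal (Set.singleton_subset_iff.mpr ⟨hrN, hur⟩)) hKc
    let w : F ⧸ closedNormalClosure r → ZMod p := Quotient.lift u fun g h hgh => by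
      have hs := QuotientGroup.leftRel_apply.mp hgh
      have := hright hs g
      rw [mul_inv_cancel_left, (hle hs).2] at this
      linear_combination -this
    refine ⟨w, isQuotientMap_quotient_mk'.continuous_iff.mpr hu, ?_⟩
    ext ⟨a, b⟩
    obtain ⟨g, rfl⟩ := QuotientGroup.mk_surjective a
    obtain ⟨h, rfl⟩ := QuotientGroup.mk_surjective b
    change u h - u (g * h) + u g = f.1 (↑g, ↑h)
    rw [hf]
    ring

/-! ### The Zassenhaus filtration. -/

section Zassenhaus

variable (p : ℕ) (G : Type u) [Group G]

theorem of_sub_one_mem_augIdeal (g : G) :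
    MonoidAlgebra.of (ZMod p) G g - 1 ∈ augIdeal p G := by
  rw [augIdeal, RingHom.mem_ker]
  simp

instance : (augIdeal p G).IsTwoSided := by
  unfold augIdeal
  infer_instance

instance (n : ℕ) : (augIdeal p G ^ n).IsTwoSided := inferInstance

/-- This follows from `[a,b] - 1 = ((a-1)(b-1) - (b-1)(a-1)) a⁻¹b⁻¹`. -/
theorem of_commutator_sub_one_mem {m n : ℕ} {a b : G}
    (ha : MonoidAlgebra.of (ZMod p) G a - 1 ∈ augIdeal p G ^ m)
    (hb : MonoidAlgebra.of (ZMod p) G b - 1 ∈ augIdeal p G ^ n) :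
    MonoidAlgebra.of (ZMod p) G ⁅a, b⁆ - 1 ∈ augIdeal p G ^ (m + n) := by
  have h1 := Ideal.mul_mem_mul ha hb
  have h2 := Ideal.mul_mem_mul hb ha
  rw [← Ideal.IsTwoSided.pow_add] at h1 h2
  rw [add_comm n m] at h2
  have h3 := Ideal.mul_mem_right (MonoidAlgebra.of (ZMod p) G (a⁻¹ * b⁻¹)) _ (sub_mem h1 h2)
  convert h3 using 1
  have e1 : ⁅a, b⁆ = a * b * (a⁻¹ * b⁻¹) := by rw [commutatorElement_def]; group
  have e2 : b * a * (a⁻¹ * b⁻¹) = 1 := by group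
  have e3 (s t : MonoidAlgebra (ZMod p) G) :
      (s - 1) * (t - 1) - (t - 1) * (s - 1) = s * t - t * s := by noncomm_ring
  rw [e3, sub_mul, ← map_mul, ← map_mul, ← map_mul, ← map_mul, ← e1, e2, map_one]

theorem of_conj_sub_one_mem {n : ℕ} {a : G}
    (ha : MonoidAlgebra.of (ZMod p) G a - 1 ∈ augIdeal p G ^ n) (b : G) :
    MonoidAlgebra.of (ZMod p) G (b * a * b⁻¹) - 1 ∈ augIdeal p G ^ n := by
  have := Ideal.mul_mem_right (MonoidAlgebra.of (ZMod p) G b⁻¹) _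
    (Ideal.mul_mem_left _ (MonoidAlgebra.of (ZMod p) G b) ha)
  rwa [mul_sub, sub_mul, mul_one, ← map_mul, ← map_mul, ← map_mul, mul_inv_cancel,
    map_one] at this

/-- In characteristic `p`, `a ^ p - 1 = (a - 1) ^ p`. -/
theorem of_pow_sub_one_mem [Fact p.Prime] (a : G) :
    MonoidAlgebra.of (ZMod p) G (a ^ p) - 1 ∈ augIdeal p G ^ p := by
  have hpow := Ideal.pow_mem_pow (of_sub_one_mem_augIdeal p G a) p
  have : CharP (MonoidAlgebra (ZMod p) G) p :=
    charP_of_injective_algebraMap (algebraMap (ZMod p) (MonoidAlgebra (ZMod p) G)).injective p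
  rwa [sub_pow_char_of_commute _ (Commute.one_right _), one_pow, ← map_pow] at hpow

variable [TopologicalSpace G]

variable {p G} in
theorem mem_zassenhaus_iff {n : ℕ} {g : G} :
    g ∈ zassenhaus p G n ↔ ∀ U : OpenNormalSubgroup G,
      MonoidAlgebra.of (ZMod p) (G ⧸ U.toSubgroup) (QuotientGroup.mk' U.toSubgroup g) - 1
        ∈ augIdeal p (G ⧸ U.toSubgroup) ^ n :=
  Iff.rfl

theorem zassenhaus_one : zassenhaus p G 1 = ⊤ := by
  refine eq_top_iff.mpr fun g _ => mem_zassenhaus_iff.mpr fun U => ?_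
  exact (Submodule.pow_one (augIdeal p (G ⧸ U.toSubgroup))).symm ▸ of_sub_one_mem_augIdeal p _ _

theorem zassenhaus_antitone : Antitone (zassenhaus p G) :=
  fun _ _ h _ hg U => Ideal.pow_le_pow_right h (hg U)

variable {p G}

theorem commutator_mem_zassenhaus {m n : ℕ} {a b : G} (ha : a ∈ zassenhaus p G m)
    (hb : b ∈ zassenhaus p G n) : ⁅a, b⁆ ∈ zassenhaus p G (m + n) := by
  rw [mem_zassenhaus_iff] at ha hb ⊢
  intro U
  rw [map_commutatorElement]
  exact of_commutator_sub_one_mem p _ (ha U) (hb U)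

theorem pow_mem_zassenhaus [Fact p.Prime] (a : G) : a ^ p ∈ zassenhaus p G p :=
  fun U => of_pow_sub_one_mem p _ (a : G ⧸ U.toSubgroup)

variable (p G)

instance (n : ℕ) : (zassenhaus p G n).Normal where
  conj_mem g hg h := by
    rw [mem_zassenhaus_iff] at hg ⊢
    intro U
    rw [map_mul (QuotientGroup.mk' U.toSubgroup), map_mul (QuotientGroup.mk' U.toSubgroup),
      map_inv]
    exact of_conj_sub_one_mem p _ (hg U) _

theorem isClosed_zassenhaus [IsTopologicalGroup G] (n : ℕ) :
    IsClosed (zassenhaus p G n : Set G) := by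
  have : (zassenhaus p G n : Set G) = ⋂ U : OpenNormalSubgroup G,
      (QuotientGroup.mk : G → G ⧸ U.toSubgroup) ⁻¹' {q | MonoidAlgebra.of (ZMod p) _ q - 1
        ∈ augIdeal p (G ⧸ U.toSubgroup) ^ n} := by
    ext g
    simp only [Set.mem_iInter]
    rfl
  rw [this]
  refine isClosed_iInter fun U => ?_
  have : DiscreteTopology (G ⧸ U.toSubgroup) := QuotientGroup.discreteTopology U.isOpen'
  exact (isClosed_discrete _).preimage QuotientGroup.continuous_mk

variable {G}

/-- For odd `p`, if `G` is topologically generated by `x` and `y`, then modulo the third term of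
the Zassenhaus filtration `G ^ p [G, G]` is generated by the commutator of `x` and `y`. -/
theorem exists_zpow_commutator_mul_mem_zassenhaus [Fact p.Prime] [IsTopologicalGroup G]
    (hp : p ≠ 2) {x y : G}
    (hgen : ∀ H : Subgroup G, IsClosed (H : Set G) → x ∈ H → y ∈ H → H = ⊤) {r : G}
    (hr : r ∈ powCommSubgroup p G) : ∃ i : ℤ, (⁅x, y⁆ ^ i)⁻¹ * r ∈ zassenhaus p G 3 := by
  have h3p : 3 ≤ p := by
    have := (Fact.out : p.Prime).two_le
    omega
  let D := zassenhaus p G 3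
  -- This is where `p` odd enters: `p`-th powers lie in the `p`-th term, hence in the third.
  have hpow (a : G) : a ^ p ∈ D := zassenhaus_antitone p G h3p (pow_mem_zassenhaus a)
  have : T3Space (G ⧸ D) := QuotientGroup.instT3Space (hN := isClosed_zassenhaus p G 3)
  let z : G ⧸ D := (⁅x, y⁆ : G)
  have hzp : z ^ p = 1 := by
    rw [← QuotientGroup.mk_pow, QuotientGroup.eq_one_iff]
    exact hpow _
  have hfin : (Subgroup.zpowers z : Set (G ⧸ D)).Finite := by
    exact finite_zpowers.mpr <| isOfFinOrder_iff_pow_eq_one.mpr ⟨p, (Fact.out : p.Prime).pos, hzp⟩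
  let M : Subgroup G := (Subgroup.zpowers z).comap (QuotientGroup.mk' D)
  have hM : IsClosed (M : Set G) := hfin.isClosed.preimage QuotientGroup.continuous_mk
  have hcomm1 (a : G) : a ∈ zassenhaus p G 1 := zassenhaus_one p G ▸ Subgroup.mem_top a
  have hcent (a b c : G) : Commute ((⁅a, b⁆ : G) : G ⧸ D) (c : G ⧸ D) := by
    rw [← commutatorElement_eq_one_iff_commute]
    exact (QuotientGroup.eq_one_iff _).mpr (commutator_mem_zassenhaus
      (commutator_mem_zassenhaus (hcomm1 a) (hcomm1 b)) (hcomm1 c))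
  have hmul (a b c : G) : ((⁅a, b * c⁆ : G) : G ⧸ D) = (⁅a, b⁆ : G) * (⁅a, c⁆ : G) := by
    have e : ⁅a, b * c⁆ = ⁅a, b⁆ * (b * ⁅a, c⁆ * b⁻¹) := by
      simp only [commutatorElement_def]; group
    rw [e, QuotientGroup.mk_mul, QuotientGroup.mk_mul, QuotientGroup.mk_mul, ← (hcent a c b).eq,
      QuotientGroup.mk_inv, mul_inv_cancel_right]
  -- Commutators are central modulo `D`, so `b ↦ [a,b]` is multiplicative there and `K a` is a
  -- subgroup. Being closed, it need only contain `x` and `y`: this is applied first to `a = x, y`,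
  -- then to arbitrary `a` by antisymmetry.
  let K (a : G) : Subgroup G :=
    { carrier := {b | ⁅a, b⁆ ∈ M}
      one_mem' := by simp [one_mem]
      mul_mem' := fun {b c} hb hc => by
        change ((⁅a, b * c⁆ : G) : G ⧸ D) ∈ Subgroup.zpowers z
        rw [hmul]
        exact mul_mem hb hc
      inv_mem' := fun {b} hb => by
        change ((⁅a, b⁻¹⁆ : G) : G ⧸ D) ∈ Subgroup.zpowers z
        have h1 := hmul a b b⁻¹
        rw [mul_inv_cancel, commutatorElement_one_right, QuotientGroup.mk_one] at h1
        rw [← inv_eq_of_mul_eq_one_right h1.symm]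
        exact inv_mem hb }
  have hK (a : G) : IsClosed (K a : Set G) :=
    hM.preimage (f := fun b => ⁅a, b⁆) (by simp only [commutatorElement_def]; fun_prop)
  have hsymm {a b : G} (h : ⁅a, b⁆ ∈ M) : ⁅b, a⁆ ∈ M := by
    rw [← commutatorElement_inv]
    exact inv_mem h
  have hxy : ⁅x, y⁆ ∈ M := Subgroup.mem_zpowers z
  have hself (a : G) : ⁅a, a⁆ ∈ M := by
    rw [commutatorElement_self]
    exact one_mem M
  have hx : K x = ⊤ := hgen _ (hK x) (hself x) hxy
  have hy : K y = ⊤ := hgen _ (hK y) (hsymm hxy) (hself y)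
  have hall (a b : G) : ⁅a, b⁆ ∈ M := by
    have : K a = ⊤ := hgen _ (hK a)
      (hsymm (hx ▸ Subgroup.mem_top a : a ∈ K x)) (hsymm (hy ▸ Subgroup.mem_top a : a ∈ K y))
    exact (this ▸ Subgroup.mem_top b : b ∈ K a)
  have hle : powCommSubgroup p G ≤ M := by
    refine Subgroup.topologicalClosure_minimal _ (sup_le ?_ ?_) hM
    · rw [Subgroup.closure_le]
      rintro _ ⟨a, rfl⟩
      change ((a ^ p : G) : G ⧸ D) ∈ Subgroup.zpowers z
      rw [(QuotientGroup.eq_one_iff _).mpr (hpow a)]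
      exact one_mem _
    · exact Subgroup.commutator_le.mpr fun a _ b _ => hall a b
  obtain ⟨i, hi⟩ := Subgroup.mem_zpowers_iff.mp (hle hr)
  refine ⟨i, ?_⟩
  rw [← QuotientGroup.eq, QuotientGroup.mk_zpow]
  exact hi

end Zassenhaus

/-! ### Unitriangular representations. -/

section Unitriangular

variable {p m : ℕ} {G : Type u} [Group G]

/-- The linear extension of a unitriangular representation to the group algebra maps the `n`-th
power of the augmentation ideal to matrices that vanish below the `n`-th superdiagonal. -/
theorem lift_apply_eq_zero_of_mem_augIdeal_pow (ρ : G →* Matrix (Fin m) (Fin m) (ZMod p))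
    (hdiag : ∀ g i, ρ g i i = 1) (htri : ∀ g i j, j < i → ρ g i j = 0) (n : ℕ) :
    ∀ a ∈ augIdeal p G ^ n, ∀ i j : Fin m, (j : ℕ) < i + n →
      MonoidAlgebra.lift (ZMod p) _ G ρ a i j = 0 := by
  have haug (a : MonoidAlgebra (ZMod p) G) (i : Fin m) :
      MonoidAlgebra.lift (ZMod p) _ G ρ a i i = MonoidAlgebra.lift (ZMod p) (ZMod p) G 1 a := by
    induction a using MonoidAlgebra.induction_on with
    | of g => simp [hdiag]
    | add a b ha hb => rw [map_add, map_add, Matrix.add_apply, ha, hb]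
    | smul c a ha => rw [map_smul, map_smul, Matrix.smul_apply, ha]
  have hlow (a : MonoidAlgebra (ZMod p) G) (i j : Fin m) (hij : j < i) :
      MonoidAlgebra.lift (ZMod p) _ G ρ a i j = 0 := by
    induction a using MonoidAlgebra.induction_on with
    | of g => simp [htri g i j hij]
    | add a b ha hb => rw [map_add, Matrix.add_apply, ha, hb, add_zero]
    | smul c a ha => rw [map_smul, Matrix.smul_apply, ha, smul_zero]
  induction n with
  | zero => exact fun a _ i j hij => hlow a i j (by simpa using hij)
  | succ n ih =>
    intro a ha
    rw [Ideal.IsTwoSided.pow_succ] at ha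
    refine Submodule.mul_induction_on ha (fun a ha b hb i j hij => ?_) fun a b ha hb i j hij => ?_
    · rw [map_mul, Matrix.mul_apply]
      refine Finset.sum_eq_zero fun k _ => ?_
      -- Terms with `k < i` vanish by triangularity, `k = i` because the diagonal of `a` is its
      -- augmentation, and `k > i` by induction, as `j < i + n + 1 ≤ k + n`.
      rcases lt_trichotomy k i with hki | rfl | hki
      · rw [hlow a i k hki, zero_mul]
      · rw [haug, (RingHom.mem_ker.mp ha :), zero_mul]
      · rw [ih b hb k j (by have : (i : ℕ) < k := hki; omega), mul_zero]
    · rw [map_add, Matrix.add_apply, ha i j hij, hb i j hij, add_zero]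

/-- A continuous unitriangular representation of dimension `m` over `𝔽_p` is trivial on the
`m`-th term of the Zassenhaus filtration. -/
theorem eq_one_of_mem_zassenhaus [TopologicalSpace G] (ρ : G →* Matrix (Fin m) (Fin m) (ZMod p))
    (hopen : IsOpen (ρ.ker : Set G)) (hdiag : ∀ g i, ρ g i i = 1)
    (htri : ∀ g i j, j < i → ρ g i j = 0) {g : G} (hg : g ∈ zassenhaus p G m) : ρ g = 1 := by
  let U : OpenNormalSubgroup G := { toSubgroup := ρ.ker, isOpen' := hopen, isNormal' := inferInstance }
  let ρ' : G ⧸ U.toSubgroup →* Matrix (Fin m) (Fin m) (ZMod p) := QuotientGroup.lift _ ρ le_rfl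
  have hρ' (h : G) : ρ' (QuotientGroup.mk' _ h) = ρ h := rfl
  ext i j
  have h1 := lift_apply_eq_zero_of_mem_augIdeal_pow ρ'
    (fun q => by obtain ⟨h, rfl⟩ := QuotientGroup.mk'_surjective _ q; exact hdiag h)
    (fun q => by obtain ⟨h, rfl⟩ := QuotientGroup.mk'_surjective _ q; exact htri h)
    m _ (mem_zassenhaus_iff.mp hg U) i j (by omega)
  rw [map_sub, map_one, Matrix.sub_apply, sub_eq_zero, MonoidAlgebra.lift_of, hρ'] at h1
  exact h1

end Unitriangular

/-! ### Cochains bounding cup products. -/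

section CupCochain

variable {p : ℕ} {G : Type u} [Group G] [TopologicalSpace G]

/-- A cochain whose coboundary is a cup product of classes of degree one vanishes on the third
term of the Zassenhaus filtration. -/
theorem apply_eq_zero_of_mem_zassenhaus (χ ψ : H1 p G) {u : G → ZMod p} (hu : Continuous u)
    (huc : ∀ g h, χ.1 g * ψ.1 h = u g + u h - u (g * h)) {g : G}
    (hg : g ∈ zassenhaus p G 3) : u g = 0 := by
  have hu1 : u 1 = 0 := by
    have := huc 1 1
    rw [H1.map_one, mul_one] at this
    linear_combination -this
  -- The sign of `u` makes the corner entry of a product match `huc`.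
  let ρ : G →* Matrix (Fin 3) (Fin 3) (ZMod p) :=
    { toFun := fun g => !![1, χ.1 g, -u g; 0, 1, ψ.1 g; 0, 0, 1]
      map_one' := by
        rw [H1.map_one, H1.map_one, hu1, neg_zero]
        exact Matrix.one_fin_three.symm
      map_mul' := fun g h => by
        ext i j
        fin_cases i <;> fin_cases j <;>
          simp [Matrix.mul_apply, Fin.sum_univ_three, χ.2.2, ψ.2.2]
        · ring
        · linear_combination -huc g h
        · ring }
  have hopen : IsOpen (ρ.ker : Set G) := by
    have : (ρ.ker : Set G) = {g | χ.1 g = 0 ∧ ψ.1 g = 0 ∧ u g = 0} := by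
      ext g
      rw [SetLike.mem_coe, MonoidHom.mem_ker, Matrix.one_fin_three]
      constructor
      · intro h
        have h01 := congrFun₂ h 0 1
        have h12 := congrFun₂ h 1 2
        have h02 := congrFun₂ h 0 2
        exact ⟨by simpa [ρ] using h01, by simpa [ρ] using h12, by simpa [ρ] using h02⟩
      · rintro ⟨h1, h2, h3⟩
        simp [ρ, h1, h2, h3]
    rw [this]
    exact ((isOpen_discrete {(0 : ZMod p)}).preimage χ.2.1).inter
      (((isOpen_discrete {(0 : ZMod p)}).preimage ψ.2.1).inter
        ((isOpen_discrete {(0 : ZMod p)}).preimage hu))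
  have h := eq_one_of_mem_zassenhaus ρ hopen
    (fun g i => by fin_cases i <;> simp [ρ])
    (fun g i j hij => by fin_cases i <;> fin_cases j <;> simp_all [ρ]) hg
  rw [Matrix.one_fin_three] at h
  simpa [ρ] using congrFun₂ h 0 2

/-- The value at `[x, y] ^ i` modulo the third term of the Zassenhaus filtration of a cochain whose
coboundary is a cup product. -/
theorem apply_eq_of_mul_mem_zassenhaus (χ ψ : H1 p G) {u : G → ZMod p} (hu : Continuous u)
    (huc : ∀ g h, χ.1 g * ψ.1 h = u g + u h - u (g * h)) {x y r : G} {i : ℤ}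
    (hr : (⁅x, y⁆ ^ i)⁻¹ * r ∈ zassenhaus p G 3) :
    u r = -i * (χ.1 x * ψ.1 y - χ.1 y * ψ.1 x) := by
  have hu1 : u 1 = 0 := by
    have := huc 1 1
    rw [H1.map_one, mul_one] at this
    linear_combination -this
  have hker (j : ℤ) : χ.1 (⁅x, y⁆ ^ j) = 0 := by
    rw [← H1.mem_ker]
    exact zpow_mem (Abelianization.commutator_subset_ker _
      (Subgroup.commutator_mem_commutator (Subgroup.mem_top x) (Subgroup.mem_top y))) j
  have hmul (j : ℤ) (h : G) : u (⁅x, y⁆ ^ j * h) = u (⁅x, y⁆ ^ j) + u h := by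
    have := huc (⁅x, y⁆ ^ j) h
    rw [hker, zero_mul] at this
    linear_combination this
  let φ : Multiplicative ℤ →* Multiplicative (ZMod p) :=
    { toFun := fun j => .ofAdd (u (⁅x, y⁆ ^ j.toAdd))
      map_one' := by simp [hu1]
      map_mul' := fun j k => by rw [toAdd_mul, zpow_add, hmul, ofAdd_add] }
  -- Compare `huc` at `(x, y)` and `(y, x)`, using `[x,y] y x = x y`.
  have hz : u ⁅x, y⁆ = -(χ.1 x * ψ.1 y - χ.1 y * ψ.1 x) := by
    have h1 := hmul 1 (y * x)
    have e : ⁅x, y⁆ ^ (1 : ℤ) * (y * x) = x * y := by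
      rw [commutatorElement_def]; group
    rw [e, zpow_one] at h1
    linear_combination -h1 + huc x y - huc y x
  have hzi : u (⁅x, y⁆ ^ i) = i * u ⁅x, y⁆ := by
    have h1 := congrArg Multiplicative.toAdd (map_zpow φ (.ofAdd 1) i)
    rw [← ofAdd_zsmul, toAdd_zpow] at h1
    simpa [φ] using h1
  have := hmul i ((⁅x, y⁆ ^ i)⁻¹ * r)
  rw [mul_inv_cancel_left, apply_eq_zero_of_mem_zassenhaus χ ψ hu huc hr, hzi, hz] at this
  linear_combination this

end CupCochain

/-! ### Cohomology of the one-relator quotient. -/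

section OneRelator

variable {p : ℕ} [Fact p.Prime] {F : Type u} [Group F] [TopologicalSpace F] [IsTopologicalGroup F]
  {x y r : F}

/-- Inflation of two-cocycles. -/
def Z2.inflate {p : ℕ} {G : Type u} [Group G] [TopologicalSpace G] (N : Subgroup G) [N.Normal]
    (f : Z2 p (G ⧸ N)) : Z2 p G :=
  ⟨fun q => f.1 (q.1, q.2),
    f.2.1.comp ((QuotientGroup.continuous_mk.comp continuous_fst).prodMk
      (QuotientGroup.continuous_mk.comp continuous_snd)),
    fun g h k => f.2.2 g h k⟩

namespace IsFreeProPOn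

theorem exists_H1_quotient (hF : IsFreeProPOn p x y) (hr : r ∈ powCommSubgroup p F)
    (a b : ZMod p) : ∃ χ : H1 p (F ⧸ closedNormalClosure r), χ.1 x = a ∧ χ.1 y = b := by
  obtain ⟨χ, hx, hy⟩ := hF.exists_H1 a b
  obtain ⟨χ', rfl⟩ := H1.exists_inflate_eq χ (H1.apply_eq_zero_of_mem_powCommSubgroup χ hr)
  exact ⟨χ', hx, hy⟩

theorem H1_quotient_ext (hF : IsFreeProPOn p x y) {χ : H1 p (F ⧸ closedNormalClosure r)}
    (hx : χ.1 x = 0) (hy : χ.1 y = 0) : χ = 0 := by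
  have h0 : H1.inflate _ χ = 0 := hF.H1_ext hx hy
  ext q
  obtain ⟨g, rfl⟩ := QuotientGroup.mk_surjective q
  exact congrFun (congrArg Subtype.val h0) g

theorem finite_H1_quotient (hF : IsFreeProPOn p x y) :
    Module.Finite (ZMod p) (H1 p (F ⧸ closedNormalClosure r)) := by
  let φ : H1 p (F ⧸ closedNormalClosure r) →ₗ[ZMod p] ZMod p × ZMod p :=
    { toFun := fun χ => (χ.1 x, χ.1 y)
      map_add' := fun _ _ => rfl
      map_smul' := fun _ _ => rfl }
  refine Module.Finite.of_injective φ ((injective_iff_map_eq_zero φ).mpr fun χ h => ?_)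
  exact hF.H1_quotient_ext (congrArg Prod.fst h) (congrArg Prod.snd h)

/-- If `r` is `[x, y] ^ i` modulo the third term of the Zassenhaus filtration, then the cup product
on the quotient by `r` is `i` times the determinant, up to a non-zero constant. -/
theorem cup_eq_zero_iff (hF : IsFreeProPOn p x y) (hr : r ∈ powCommSubgroup p F) {i : ℤ}
    (hi : (⁅x, y⁆ ^ i)⁻¹ * r ∈ zassenhaus p F 3)
    (χ ψ : H1 p (F ⧸ closedNormalClosure r)) :
    cup p _ χ ψ = 0 ↔ (i : ZMod p) * (χ.1 x * ψ.1 y - χ.1 y * ψ.1 x) = 0 := by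
  -- The values `0, 0` on the generators are arbitrary: other choices change `u` by a homomorphism,
  -- which vanishes at `r`.
  obtain ⟨u, hu, huc, -⟩ :=
    hF.exists_eq_coboundary (Z2.inflate _ (cupCocycle p _ χ ψ)) 0 0
  have hur : u r = -i * (χ.1 x * ψ.1 y - χ.1 y * ψ.1 x) :=
    apply_eq_of_mul_mem_zassenhaus (H1.inflate _ χ) (H1.inflate _ ψ) hu huc hi
  have hu1 : u 1 = 0 :=
    apply_eq_zero_of_mem_zassenhaus (H1.inflate _ χ) (H1.inflate _ ψ) hu huc (one_mem _)
  have h1 : cup p _ χ ψ = 0 ↔ cupCocycle p _ χ ψ ∈ B2 p (F ⧸ closedNormalClosure r) :=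
    Submodule.Quotient.mk_eq_zero _
  rw [h1, mem_B2_iff (fun χ => H1.apply_eq_zero_of_mem_powCommSubgroup χ hr) _ hu huc, hur, hu1,
    neg_mul, neg_eq_zero]

/-- Any two classes in degree two on the quotient by one relator are linearly dependent. -/
theorem exists_smul_eq_H2 (hF : IsFreeProPOn p x y) (hr : r ∈ powCommSubgroup p F)
    {v : H2 p (F ⧸ closedNormalClosure r)} (hv : v ≠ 0) (w : H2 p (F ⧸ closedNormalClosure r)) :
    ∃ c : ZMod p, c • v = w := by
  obtain ⟨f, rfl⟩ := Submodule.Quotient.mk_surjective _ v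
  obtain ⟨g, rfl⟩ := Submodule.Quotient.mk_surjective _ w
  obtain ⟨u, hu, huf, -⟩ := hF.exists_eq_coboundary (Z2.inflate _ f) 0 0
  obtain ⟨t, ht, htg, -⟩ := hF.exists_eq_coboundary (Z2.inflate _ g) 0 0
  have hH1 (χ : H1 p F) : χ.1 r = 0 := H1.apply_eq_zero_of_mem_powCommSubgroup χ hr
  have hne : u r - u 1 ≠ 0 := by
    rwa [Ne, Submodule.Quotient.mk_eq_zero, mem_B2_iff hH1 f hu huf, ← sub_eq_zero] at hv
  -- The ratio of transgressions: the resulting combination of `u` and `t` has equal values at `r`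
  -- and `1`.
  refine ⟨(t r - t 1) / (u r - u 1), ?_⟩
  rw [← Submodule.Quotient.mk_smul, Submodule.Quotient.eq]
  refine (mem_B2_iff hH1 _ (u := fun g => (t r - t 1) / (u r - u 1) * u g - t g)
    ((continuous_const.mul hu).sub ht) fun a b => ?_).mpr ?_
  · have h1 : f.1 (a, b) = _ := huf a b
    have h2 : g.1 (a, b) = _ := htg a b
    change (t r - t 1) / (u r - u 1) * f.1 (a, b) - g.1 (a, b) = _
    rw [h1, h2]
    ring
  · field_simp
    ring

/-- The cup form is a nonzero multiple of the determinant. The dual basis `χ₁, χ₂` has determinant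
one, so `χ₁ ∪ χ₂` spans `H²`; pairing with `χ₁` and `χ₂` recovers, up to sign, the values at `y` and
`x`. -/
theorem isDemushkin_quotient (hF : IsFreeProPOn p x y) (hr : r ∈ powCommSubgroup p F) {i : ℤ}
    (hi : IsCoprime i (p : ℤ)) (hri : (⁅x, y⁆ ^ i)⁻¹ * r ∈ zassenhaus p F 3) :
    IsDemushkin p (F ⧸ closedNormalClosure r) := by
  have hi0 : (i : ZMod p) ≠ 0 := by
    rw [Ne, ZMod.intCast_zmod_eq_zero_iff_dvd]
    intro hdvd
    have := hi.isUnit_of_dvd' hdvd dvd_rfl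
    exact (Nat.prime_iff_prime_int.mp Fact.out).not_isUnit this
  have hcup (χ ψ : H1 p (F ⧸ closedNormalClosure r)) :
      cup p _ χ ψ = 0 ↔ χ.1 x * ψ.1 y - χ.1 y * ψ.1 x = 0 := by
    rw [hF.cup_eq_zero_iff hr hri, mul_eq_zero, or_iff_right hi0]
  obtain ⟨χ₁, h1x, h1y⟩ := hF.exists_H1_quotient hr 1 0
  obtain ⟨χ₂, h2x, h2y⟩ := hF.exists_H1_quotient hr 0 1
  refine ⟨hF.isProP.quotient _ (Subgroup.isClosed_topologicalClosure _), hF.finite_H1_quotient,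
    finrank_eq_one_iff'.mpr ⟨cup p _ χ₁ χ₂, ?_, ?_⟩, fun χ h => ?_, fun χ h => ?_⟩
  · rw [Ne, hcup, h1x, h1y, h2y]
    simp
  · exact hF.exists_smul_eq_H2 hr (by rw [Ne, hcup, h1x, h1y, h2y]; simp)
  · have e1 := (hcup _ _).mp (h χ₁)
    have e2 := (hcup _ _).mp (h χ₂)
    rw [h1x, h1y] at e1
    rw [h2x, h2y] at e2
    exact hF.H1_quotient_ext (by linear_combination e2) (by linear_combination -e1)
  · have e1 := (hcup _ _).mp (h χ₁)
    have e2 := (hcup _ _).mp (h χ₂)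
    rw [h1x, h1y] at e1
    rw [h2x, h2y] at e2
    exact hF.H1_quotient_ext (by linear_combination -e2) (by linear_combination e1)

/-- If `p` divided the exponent, the cup product would vanish identically, although `H¹` contains a
class with value `1` at `x`. -/
theorem exists_zpow_of_isDemushkin_quotient (hp : p ≠ 2) (hF : IsFreeProPOn p x y)
    (hr : r ∈ powCommSubgroup p F) (hD : IsDemushkin p (F ⧸ closedNormalClosure r)) :
    ∃ i : ℤ, IsCoprime i (p : ℤ) ∧ (⁅x, y⁆ ^ i)⁻¹ * r ∈ zassenhaus p F 3 := by
  obtain ⟨i, hi⟩ := exists_zpow_commutator_mul_mem_zassenhaus p hp (x := x) (y := y)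
    (fun H hH hx hy => eq_top_iff.mpr fun g _ => hF.mem_of_isClosed H hH hx hy g) hr
  refine ⟨i, ?_, hi⟩
  rw [isCoprime_comm, (Nat.prime_iff_prime_int.mp Fact.out).coprime_iff_not_dvd,
    ← ZMod.intCast_zmod_eq_zero_iff_dvd]
  intro hi0
  obtain ⟨χ, hx, -⟩ := hF.exists_H1_quotient hr 1 0
  have h0 : χ = 0 := hD.nondegenerate.1 χ fun ψ => by
    rw [hF.cup_eq_zero_iff hr hi, hi0, zero_mul]
  rw [h0] at hx
  exact zero_ne_one hx

end IsFreeProPOn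

end OneRelator

theorem mainTheorem4 (p : ℕ) [Fact p.Prime] {F : Type u} [Group F] [TopologicalSpace F]
    [IsTopologicalGroup F] (x y : F) (hF : IsFreeProPOn p x y)
    (r : F) (hr : r ∈ powCommSubgroup p F) :
    ((∃ i : ℤ, IsCoprime i (p : ℤ) ∧ (⁅x, y⁆ ^ i)⁻¹ * r ∈ zassenhaus p F 3) →
      IsDemushkin p (F ⧸ closedNormalClosure r)) ∧
    (p ≠ 2 → IsDemushkin p (F ⧸ closedNormalClosure r) →
      ∃ i : ℤ, IsCoprime i (p : ℤ) ∧ (⁅x, y⁆ ^ i)⁻¹ * r ∈ zassenhaus p F 3) :=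
  ⟨fun ⟨_, hi, hri⟩ => hF.isDemushkin_quotient hr hi hri,
    fun hp hD => hF.exists_zpow_of_isDemushkin_quotient hp hr hD⟩
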